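/- Let $\sigma_h,\sigma_y:\mathbb R\to\mathbb R$ be Lipschitz with constants $\rho_h,\rho_y$, with $\sigma_h(0)=\sigma_y(0)=0$ and $|\sigma_h|\le b$. A vanilla RNN with weights $U\in\mathbb R^{d_h\times d_h}$, $V\in\mathbb R^{d_y\times d_h}$, $W\in\mathbb R^{d_h\times d_x}$ maps inputs $x_1,\dots,x_t\in\mathbb R^{d_x}$ to $y_t=\sigma_y(Vh_t)$, where $h_0=0$, $h_s=\sigma_h(Uh_{s-1}+Wx_s)$ and the activations act entrywise. Let $\mathcal F_t$ be the class of all maps $f_t:X_t=(x_1,\dots,x_t)\mapsto y_t$ obtained from weights with spectral norms $\|U\|_2\le B_U$, $\|V\|_2\le B_V$, $\|W\|_2\le B_W$. Labels lie in $\{1,\dots,K\}$ with $K=d_y$, and the predicted label is $\tilde z_t=\arg\max_j[f_t(X_t)]_j$, with ties broken arbitrarily. The margin is $\mathcal M(y,z)=y_z-\max_{j\ne z}y_j$, the ramp loss is $\mathcal L_\gamma(a)=\mathbf 1\{a>0\}+(1+a/\gamma)\mathbf 1\{-\gamma\le a\le 0\}$, and for samples $S=\{(x_{i,t},z_{i,t})_{t=1}^T: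 i=1,\dots,m\}$ the empirical ramp risk is $\hat{\mathcal R}_\gamma(f_t)=\frac1m\sum_{i=1}^m\mathcal L_\gamma(-\mathcal M(f_t(X_{i,t}),z_{i,t}))$, where $X_{i,t}=(x_{i,1},\dots,x_{i,t})$. Put $d=\sqrt{d_xd_h+d_h^2+d_hd_y}$, $\beta=\rho_hB_U$ and $\lambda_t=\min\{b\sqrt d,\ \rho_hB_xB_W\frac{\beta^t-1}{\beta-1}\}$, where $\frac{\beta^t-1}{\beta-1}$ means $t$ if $\beta=1$. There is an absolute constant $C>0$, and for all nonnegative constants $\rho_h,\rho_y,b,B_x,B_U,B_V,B_W$ there is $m_0$ depending only on these constants, such that the following holds for all $d_x,d_h,d_y,T$, all such activations, every probability distribution of a sequence $(x_t,z_t)_{t=1}^T\in(\mathbb R^{d_x}\times\{1,\dots,K\})^T$ with $\|x_t\|_2\le B_x$ almost surely for all $t$, every $m\ge m_0$ and every $\delta\in(0,1)$. If $S$ consists of $m$ i.i.d. sequences from this distribution, then with probability at least $1-\delta$ over $S$, simultaneously for every $\gamma>0$, every integer $1\le t\le T$ and every $f_t\in\mathcal F_t$, $$\mathbb P(\tilde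 z_t\ne z_t)\ \le\ \hat{\mathcal R}_\gamma(f_t)+3\sqrt{\frac{\log(2/\delta)}{2m}}+C\,\frac{d\,\rho_y\,B_V\,\lambda_t\sqrt{\log\!\big(t\sqrt{dm}\,\frac{\beta^t-1}{\beta-1}\big)}}{\sqrt m\,\gamma},$$ where the probability on the left is over an independent test sequence from the same distribution. -/

import Mathlib

open MeasureTheory
open scoped NNReal Matrix

noncomputable section

namespace VanillaRNN

/-- A labelled sequence `(x_t, z_t)`, `t = 1, …, T`, with inputs in `ℝ^dx` and labels in a set of
`K` classes. The entry with index `t : Fin T` is the one of time `t + 1`. -/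
abbrev LabelledSeq (dx K T : ℕ) : Type :=
  Fin T → EuclideanSpace ℝ (Fin dx) × Fin K

/-- The spectral norm of a real matrix: its operator norm for the Euclidean norms. -/
def specNorm {p q : ℕ} (A : Matrix (Fin p) (Fin q) ℝ) : ℝ :=
  ‖(Matrix.toEuclideanLin A).toContinuousLinearMap‖

/-- A scalar activation applied entrywise. -/
def entrywise (σ : ℝ → ℝ) {p : ℕ} (v : Fin p → ℝ) : EuclideanSpace ℝ (Fin p) :=
  WithLp.toLp 2 (fun i => σ (v i))

/-- The hidden state after reading the inputs `x_1, …, x_t`: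
`h_0 = 0` and `h_t = σ_h (U h_{t-1} + W x_t)`. -/
def hidden (σh : ℝ → ℝ) {dx dh : ℕ} (U : Matrix (Fin dh) (Fin dh) ℝ)
    (W : Matrix (Fin dh) (Fin dx) ℝ) :
    (t : ℕ) → (Fin t → EuclideanSpace ℝ (Fin dx)) → EuclideanSpace ℝ (Fin dh)
  | 0, _ => 0
  | t + 1, X =>
      entrywise σh (U *ᵥ (hidden σh U W t (fun i => X i.castSucc)).ofLp
        + W *ᵥ (X (Fin.last t)).ofLp)

/-- The `t`-th output `y_t = σ_y (V h_t)` as a function of the first `t` inputs. -/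
def output (σh σy : ℝ → ℝ) {dx dh K : ℕ} (U : Matrix (Fin dh) (Fin dh) ℝ)
    (V : Matrix (Fin K) (Fin dh) ℝ) (W : Matrix (Fin dh) (Fin dx) ℝ) (t : ℕ)
    (X : Fin t → EuclideanSpace ℝ (Fin dx)) : EuclideanSpace ℝ (Fin K) :=
  entrywise σy (V *ᵥ (hidden σh U W t X).ofLp)

/-- The class `F_t` of all maps `(x_1, …, x_t) ↦ y_t` computed by vanilla RNNs whose weight
matrices have spectral norms bounded by `BU`, `BV`, `BW`. -/
def rnnClass (σh σy : ℝ → ℝ) (dx dh K : ℕ) (BU BV BW : ℝ) (t : ℕ) :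
    Set ((Fin t → EuclideanSpace ℝ (Fin dx)) → EuclideanSpace ℝ (Fin K)) :=
  {f | ∃ (U : Matrix (Fin dh) (Fin dh) ℝ) (V : Matrix (Fin K) (Fin dh) ℝ)
      (W : Matrix (Fin dh) (Fin dx) ℝ),
      specNorm U ≤ BU ∧ specNorm V ≤ BV ∧ specNorm W ≤ BW ∧ f = output σh σy U V W t}

/-- The inputs `x_1, …, x_{t+1}` of a labelled sequence. -/
def inputs {dx K T : ℕ} (s : LabelledSeq dx K T) (t : Fin T) :
    Fin (t.val + 1) → EuclideanSpace ℝ (Fin dx) :=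
  fun i => (s (Fin.castLE t.isLt i)).1

/-- The label of a labelled sequence at the index `t`. -/
def label {dx K T : ℕ} (s : LabelledSeq dx K T) (t : Fin T) : Fin K :=
  (s t).2

/-- The functional margin `y_z - max_{j ≠ z} y_j` (for `K = 1` the maximum over the empty set
is read as `0`). -/
def margin {K : ℕ} (y : EuclideanSpace ℝ (Fin K)) (z : Fin K) : ℝ :=
  y z - ⨆ j : {j : Fin K // j ≠ z}, y j.1

open Classical in
/-- The ramp loss `1{a > 0} + (1 + a / γ) 1{-γ ≤ a ≤ 0}`. -/
def ramp (γ a : ℝ) : ℝ :=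
  (if 0 < a then 1 else 0) + (1 + a / γ) * (if -γ ≤ a ∧ a ≤ 0 then 1 else 0)

/-- The empirical ramp risk at the index `t` on the samples `S 0, …, S (m - 1)`. -/
def empRampRisk {dx K T m : ℕ} (γ : ℝ) (S : Fin m → LabelledSeq dx K T) (t : Fin T)
    (f : (Fin (t.val + 1) → EuclideanSpace ℝ (Fin dx)) → EuclideanSpace ℝ (Fin K)) : ℝ :=
  (1 / (m : ℝ)) * ∑ i, ramp γ (-margin (f (inputs (S i) t)) (label (S i) t))

/-- The misclassification probability at the index `t`, on a test sequence with law `P`, when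
`φ` turns an output into a predicted label. -/
def misclass {dx K T : ℕ} (P : Measure (LabelledSeq dx K T))
    (φ : EuclideanSpace ℝ (Fin K) → Fin K) (t : Fin T)
    (f : (Fin (t.val + 1) → EuclideanSpace ℝ (Fin dx)) → EuclideanSpace ℝ (Fin K)) : ℝ :=
  P.real {s | φ (f (inputs s t)) ≠ label s t}

open Classical in
/-- `(β ^ t - 1) / (β - 1)`, which is read as `t` for `β = 1`. -/
def geomRatio (β : ℝ) (t : ℕ) : ℝ :=
  if β = 1 then (t : ℝ) else (β ^ t - 1) / (β - 1)

/-- `d = √(dx dh + dh² + dh dy)`, with `dy = K`. -/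
def effDim (dx dh K : ℕ) : ℝ :=
  √((dx : ℝ) * dh + (dh : ℝ) ^ 2 + (dh : ℝ) * K)

/-- `λ_t = min {b √d, ρ_h B_x B_W (β ^ t - 1) / (β - 1)}`. -/
def lam (b d ρh Bx BW β : ℝ) (t : ℕ) : ℝ :=
  min (b * √d) (ρh * Bx * BW * geomRatio β t)

/-- The complexity term
`d ρ_y B_V λ_t √(log (t √(d m) (β ^ t - 1) / (β - 1))) / (√m γ)`, with `β = ρ_h B_U`. -/
def complexityTerm (d ρh ρy b Bx BU BV BW : ℝ) (m t : ℕ) (γ : ℝ) : ℝ :=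
  d * ρy * BV * lam b d ρh Bx BW (ρh * BU) t
      * √(Real.log ((t : ℝ) * √(d * (m : ℝ)) * geomRatio (ρh * BU) t))
    / (√(m : ℝ) * γ)

end VanillaRNN

end

/-!
The proof is a direct union bound over a finite net of networks; no symmetrization is needed, since
the bound to be proved contains the logarithm that a single-scale net produces.

*Net.* A network has `d ^ 2 = dx dh + dh ^ 2 + dh K` weights, each bounded by the spectral norm of
its matrix. Rounding all of them to `n` levels gives an internal net with at most
`(2 n + 1) ^ (d ^ 2)` members (`exists_net_specNorm_ball`). An error in the weights is amplified
along the recursion by at most `(β ^ t - 1) / (β - 1)` (`norm_hidden_sub_le`), so `n` of order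
`d √m (β ^ t - 1) / (β - 1)` suffices for the outputs to move by at most `1 / √m` times their maximal
size `ρy BV λ_t` (`exists_net_output`). The implied factor `β + 2 + ρh Bx BW / b` depends only on the
constants, and the threshold `m₀` makes `√m` dominate it inside the logarithm.

*All scales at once.* Let `Λ = 2 ρy BV λ_t`, which bounds the margins. A fixed network and scale is
handled by Hoeffding's inequality, and only the scales `Λ / k` with `1 ≤ k ≤ m` enter the union bound
(`measureReal_error_le_of_grid`). The ramp loss increases with `γ`, so a `γ` with `Λ / m ≤ γ ≤ Λ` may
be replaced by the next smaller such scale, which is at least `γ / 2`. For `γ > Λ` the ramp loss of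
a margin at most `Λ` is `(1 - Λ / γ)` plus `Λ / γ` times the ramp loss at scale `Λ`
(`ramp_eq_affine`); thus the deviation shrinks by the factor `Λ / γ`, as the complexity term does.
For `γ < Λ / m` the complexity term exceeds `1`.

*All times at once.* Time `t` receives the failure probability `δ / (t (t + 1))`. These add up to at
most `δ` for every `T`, and the factor `t (t + 1)` is absorbed by the `t` inside the logarithm
(`log_union_le`).

The degenerate cases (`b = 0`, no hidden units, vanishing weights) have all outputs equal to `0`;
then all margins vanish and the ramp risk is `1`.
-/

namespace VanillaRNN

/-! ### Spectral norms and entries -/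

lemma specNorm_nonneg {p q : ℕ} (A : Matrix (Fin p) (Fin q) ℝ) : 0 ≤ specNorm A :=
  norm_nonneg _

lemma norm_mulVec_le {p q : ℕ} (A : Matrix (Fin p) (Fin q) ℝ) (v : EuclideanSpace ℝ (Fin q)) :
    ‖(WithLp.toLp 2 (A *ᵥ v.ofLp) : EuclideanSpace ℝ (Fin p))‖ ≤ specNorm A * ‖v‖ :=
  (Matrix.toEuclideanLin A).toContinuousLinearMap.le_opNorm v

lemma abs_coord_le_norm {p : ℕ} (v : EuclideanSpace ℝ (Fin p)) (i : Fin p) : |v i| ≤ ‖v‖ := by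
  simpa using PiLp.norm_apply_le v i

lemma abs_entry_le_specNorm {p q : ℕ} (A : Matrix (Fin p) (Fin q) ℝ) (i : Fin p) (j : Fin q) :
    |A i j| ≤ specNorm A := by
  have h := norm_mulVec_le A (EuclideanSpace.single j (1 : ℝ))
  have h2 := abs_coord_le_norm
    (WithLp.toLp 2 (A *ᵥ (EuclideanSpace.single j (1 : ℝ)).ofLp) : EuclideanSpace ℝ (Fin p)) i
  have h3 : (WithLp.toLp 2 (A *ᵥ (EuclideanSpace.single j (1 : ℝ)).ofLp) :
      EuclideanSpace ℝ (Fin p)) i = A i j := by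
    simp
  rw [h3] at h2
  simpa using h2.trans h

/-- The spectral norm is at most the Frobenius norm. -/
lemma specNorm_le_of_abs_entry_le {p q : ℕ} (A : Matrix (Fin p) (Fin q) ℝ) {η : ℝ} (hη : 0 ≤ η)
    (hA : ∀ i j, |A i j| ≤ η) : specNorm A ≤ √((p : ℝ) * q) * η := by
  refine ContinuousLinearMap.opNorm_le_bound _ (by positivity) fun v => ?_
  change ‖(WithLp.toLp 2 (A *ᵥ v.ofLp) : EuclideanSpace ℝ (Fin p))‖ ≤ _
  refine le_of_sq_le_sq ?_ (by positivity)
  rw [EuclideanSpace.real_norm_sq_eq, mul_pow, mul_pow, Real.sq_sqrt (by positivity),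
    EuclideanSpace.real_norm_sq_eq]
  have hrow : ∀ i, ((WithLp.toLp 2 (A *ᵥ v.ofLp) : EuclideanSpace ℝ (Fin p)) i) ^ 2
      ≤ q * η ^ 2 * ∑ j, v j ^ 2 := by
    intro i
    have hcs := Finset.sum_mul_sq_le_sq_mul_sq Finset.univ (fun j => A i j) (fun j => v j)
    refine hcs.trans (mul_le_mul_of_nonneg_right ?_ (by positivity))
    calc ∑ j, A i j ^ 2 ≤ ∑ _j : Fin q, η ^ 2 := by
          refine Finset.sum_le_sum fun j _ => ?_
          rw [← sq_abs]
          exact pow_le_pow_left₀ (abs_nonneg _) (hA i j) 2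
      _ = q * η ^ 2 := by simp
  calc _ ≤ ∑ _i : Fin p, (q * η ^ 2 * ∑ j, v j ^ 2) := Finset.sum_le_sum fun i _ => hrow i
    _ = _ := by simp; ring

/-- A set whose elements are coded by a finite type has a finite subset of representatives, one
for each code in use. -/
lemma exists_finset_representatives {α κ : Type*} [Fintype κ] (s : Set α) (code : α → κ) :
    ∃ F : Finset α, (∀ a ∈ F, a ∈ s) ∧ F.card ≤ Fintype.card κ ∧
      ∀ a ∈ s, ∃ a' ∈ F, code a' = code a := by
  classical
  obtain ⟨r, hrs, hr⟩ := Set.exists_subset_bijOn s code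
  have hfin : r.Finite := Set.Finite.of_injOn (t := Set.univ) (fun _ _ => Set.mem_univ _)
    hr.injOn Set.finite_univ
  refine ⟨hfin.toFinset, fun a ha => hrs (hfin.mem_toFinset.1 ha), ?_, fun a ha => ?_⟩
  · refine Finset.card_le_card_of_injOn code (fun _ _ => Finset.mem_univ _) ?_
    simpa using hr.injOn
  · obtain ⟨a', ha', h⟩ := hr.surjOn (Set.mem_image_of_mem code ha)
    exact ⟨a', hfin.mem_toFinset.2 ha', h⟩

/-- An internal net of the spectral norm ball of radius `B`, obtained by rounding the entries to
multiples of `B / n`. -/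
lemma exists_net_specNorm_ball (p q : ℕ) {B : ℝ} (hB : 0 ≤ B) {n : ℕ} (hn : 0 < n) :
    ∃ F : Finset (Matrix (Fin p) (Fin q) ℝ), (∀ A ∈ F, specNorm A ≤ B) ∧
      F.card ≤ (2 * n + 1) ^ (p * q) ∧
      ∀ A, specNorm A ≤ B → ∃ A' ∈ F, specNorm (A - A') ≤ √((p : ℝ) * q) * (B / n) := by
  classical
  have hn' : (0 : ℝ) < n := by exact_mod_cast hn
  let I := Finset.Icc (-(n : ℤ)) n
  have h0 : (0 : ℤ) ∈ I := by simp [I]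
  let code : Matrix (Fin p) (Fin q) ℝ → (Fin p × Fin q → I) := fun A ij =>
    if h : ⌊n * (A ij.1 ij.2 / B)⌋ ∈ I then ⟨_, h⟩ else ⟨0, h0⟩
  obtain ⟨F, hF, hcard, hrep⟩ := exists_finset_representatives {A | specNorm A ≤ B} code
  refine ⟨F, hF, hcard.trans_eq ?_, fun A hA => ?_⟩
  · simp [I]
    congr 1
    omega
  have hmem : ∀ A : Matrix (Fin p) (Fin q) ℝ, specNorm A ≤ B → ∀ i j,
      ⌊n * (A i j / B)⌋ ∈ I := by
    intro A hA i j
    have h1 : |A i j / B| ≤ 1 := by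
      rw [abs_div, abs_of_nonneg hB]
      exact div_le_one_of_le₀ ((abs_entry_le_specNorm A i j).trans hA) hB
    rw [abs_le] at h1
    simp only [I, Finset.mem_Icc]
    constructor
    · rw [Int.le_floor]; push_cast; nlinarith
    · have : (⌊n * (A i j / B)⌋ : ℝ) ≤ n := (Int.floor_le _).trans (by nlinarith)
      exact_mod_cast this
  obtain ⟨A', hA', hcode⟩ := hrep A hA
  refine ⟨A', hA', specNorm_le_of_abs_entry_le _ (by positivity) fun i j => ?_⟩
  have hij := congrArg Subtype.val (congrFun hcode (i, j))
  simp only [code, dif_pos (hmem A hA i j), dif_pos (hmem A' (hF A' hA') i j)] at hij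
  rcases hB.eq_or_lt with rfl | hB
  · -- for `B = 0` the rounding is meaningless, but all entries vanish
    have e1 := (abs_entry_le_specNorm A i j).trans hA
    have e2 := (abs_entry_le_specNorm A' i j).trans (hF A' hA')
    have e1' := abs_nonpos_iff.1 e1
    have e2' := abs_nonpos_iff.1 e2
    simp [e1', e2']
  · have h := (Int.abs_sub_lt_one_of_floor_eq_floor hij).le
    rw [← mul_sub, abs_mul, ← sub_div, abs_div, abs_of_pos hn', abs_of_pos hB, abs_sub_comm] at h
    rw [Matrix.sub_apply, le_div_iff₀ hn']
    rw [← mul_div_assoc, div_le_one hB] at h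
    linarith

/-! ### Size and stability of the hidden states -/

lemma geomRatio_eq_sum (β : ℝ) (t : ℕ) : geomRatio β t = ∑ i ∈ Finset.range t, β ^ i := by
  unfold geomRatio
  split_ifs with h
  · simp [h]
  · rw [geom_sum_eq h]

lemma geomRatio_succ (β : ℝ) (t : ℕ) : geomRatio β (t + 1) = 1 + β * geomRatio β t := by
  rw [geomRatio_eq_sum, geomRatio_eq_sum, geom_sum_succ, add_comm]

lemma geomRatio_nonneg {β : ℝ} (hβ : 0 ≤ β) (t : ℕ) : 0 ≤ geomRatio β t := by
  rw [geomRatio_eq_sum]; positivity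

lemma geomRatio_mono {β : ℝ} (hβ : 0 ≤ β) : Monotone (geomRatio β) := by
  refine monotone_nat_of_le_succ fun t => ?_
  rw [geomRatio_eq_sum, geomRatio_eq_sum, Finset.sum_range_succ]
  have := pow_nonneg hβ t
  linarith

lemma one_le_geomRatio_succ {β : ℝ} (hβ : 0 ≤ β) (t : ℕ) : 1 ≤ geomRatio β (t + 1) := by
  rw [geomRatio_succ]
  have := mul_nonneg hβ (geomRatio_nonneg hβ t)
  linarith

lemma norm_entrywise_sub_le {σ : ℝ → ℝ} {ρ : ℝ≥0} (hσ : LipschitzWith ρ σ) {p : ℕ}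
    (v w : Fin p → ℝ) :
    ‖entrywise σ v - entrywise σ w‖
      ≤ ρ * ‖(WithLp.toLp 2 (v - w) : EuclideanSpace ℝ (Fin p))‖ := by
  refine le_of_sq_le_sq ?_ (by positivity)
  rw [EuclideanSpace.real_norm_sq_eq, mul_pow, EuclideanSpace.real_norm_sq_eq, Finset.mul_sum]
  refine Finset.sum_le_sum fun i _ => ?_
  have h := hσ.dist_le_mul (v i) (w i)
  rw [Real.dist_eq, Real.dist_eq] at h
  rw [← mul_pow]
  refine sq_le_sq.2 ?_
  rw [abs_mul, NNReal.abs_eq]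
  exact h

lemma norm_entrywise_le {σ : ℝ → ℝ} {ρ : ℝ≥0} (hσ : LipschitzWith ρ σ) (h0 : σ 0 = 0) {p : ℕ}
    (v : Fin p → ℝ) :
    ‖entrywise σ v‖ ≤ ρ * ‖(WithLp.toLp 2 v : EuclideanSpace ℝ (Fin p))‖ := by
  have h := norm_entrywise_sub_le hσ v 0
  have h1 : entrywise σ (0 : Fin p → ℝ) = 0 := by ext i; simp [entrywise, h0]
  simpa [h1] using h

lemma norm_entrywise_le_of_bounded {σ : ℝ → ℝ} {b : ℝ} (hb : 0 ≤ b) (hσ : ∀ v, |σ v| ≤ b) {p : ℕ}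
    (v : Fin p → ℝ) : ‖entrywise σ v‖ ≤ b * √p := by
  refine le_of_sq_le_sq ?_ (by positivity)
  rw [EuclideanSpace.real_norm_sq_eq, mul_pow, Real.sq_sqrt (by positivity)]
  calc _ ≤ ∑ _i : Fin p, b ^ 2 := by
        refine Finset.sum_le_sum fun i _ => ?_
        exact sq_le_sq' (abs_le.1 (hσ _)).1 (abs_le.1 (hσ _)).2
    _ = _ := by simp [mul_comm]

section

variable {σh σy : ℝ → ℝ} {ρh ρy : ℝ≥0} {dx dh K : ℕ}

lemma norm_hidden_le_geomRatio (hσ : LipschitzWith ρh σh) (h0 : σh 0 = 0)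
    {U : Matrix (Fin dh) (Fin dh) ℝ} {W : Matrix (Fin dh) (Fin dx) ℝ} {BU BW Bx : ℝ}
    (hU : specNorm U ≤ BU) (hW : specNorm W ≤ BW) :
    ∀ (t : ℕ) (X : Fin t → EuclideanSpace ℝ (Fin dx)), (∀ i, ‖X i‖ ≤ Bx) →
      ‖hidden σh U W t X‖ ≤ ρh * Bx * BW * geomRatio (ρh * BU) t
  | 0, _, _ => by simp [hidden, geomRatio_eq_sum]
  | t + 1, X, hX => by
    have ih := norm_hidden_le_geomRatio hσ h0 hU hW t (fun i => X i.castSucc) fun i => hX _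
    set h := hidden σh U W t (fun i => X i.castSucc) with hh
    have hBU : 0 ≤ BU := (specNorm_nonneg U).trans hU
    have hBW : 0 ≤ BW := (specNorm_nonneg W).trans hW
    have hx := hX (Fin.last t)
    have e1 : ‖hidden σh U W (t + 1) X‖ ≤ ρh * (specNorm U * ‖h‖ + specNorm W * ‖X (Fin.last t)‖) :=
      (norm_entrywise_le hσ h0 _).trans (mul_le_mul_of_nonneg_left
        ((norm_add_le _ _).trans (add_le_add (norm_mulVec_le U h) (norm_mulVec_le W _))) ρh.2)
    have e2 : specNorm U * ‖h‖ ≤ BU * (ρh * Bx * BW * geomRatio (ρh * BU) t) :=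
      mul_le_mul hU ih (norm_nonneg _) hBU
    have e3 : specNorm W * ‖X (Fin.last t)‖ ≤ BW * Bx := mul_le_mul hW hx (norm_nonneg _) hBW
    rw [geomRatio_succ]
    calc _ ≤ _ := e1
      _ ≤ ρh * (BU * (ρh * Bx * BW * geomRatio (ρh * BU) t) + BW * Bx) :=
        mul_le_mul_of_nonneg_left (add_le_add e2 e3) ρh.2
      _ = _ := by ring

lemma norm_hidden_le_of_bounded {b : ℝ} (hb : 0 ≤ b) (hσ : ∀ v, |σh v| ≤ b)
    (U : Matrix (Fin dh) (Fin dh) ℝ) (W : Matrix (Fin dh) (Fin dx) ℝ) :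
    ∀ (t : ℕ) (X : Fin t → EuclideanSpace ℝ (Fin dx)), ‖hidden σh U W t X‖ ≤ b * √dh
  | 0, _ => by simp [hidden]; positivity
  | _ + 1, _ => norm_entrywise_le_of_bounded hb hσ _

lemma natCast_dh_le_effDim (dx dh K : ℕ) : (dh : ℝ) ≤ effDim dx dh K := by
  refine Real.le_sqrt_of_sq_le ?_
  have h1 : (0 : ℝ) ≤ (dx : ℝ) * dh := by positivity
  have h2 : (0 : ℝ) ≤ (dh : ℝ) * K := by positivity
  linarith

lemma norm_hidden_le_lam {b BU BW Bx : ℝ} (hb : 0 ≤ b) (hσ : LipschitzWith ρh σh)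
    (h0 : σh 0 = 0) (hσb : ∀ v, |σh v| ≤ b)
    {U : Matrix (Fin dh) (Fin dh) ℝ} {W : Matrix (Fin dh) (Fin dx) ℝ}
    (hU : specNorm U ≤ BU) (hW : specNorm W ≤ BW) (K t : ℕ)
    (X : Fin t → EuclideanSpace ℝ (Fin dx)) (hX : ∀ i, ‖X i‖ ≤ Bx) :
    ‖hidden σh U W t X‖ ≤ lam b (effDim dx dh K) ρh Bx BW (ρh * BU) t := by
  unfold lam
  exact le_min ((norm_hidden_le_of_bounded hb hσb U W t X).trans (mul_le_mul_of_nonneg_left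
    (Real.sqrt_le_sqrt (natCast_dh_le_effDim dx dh K)) hb))
    (norm_hidden_le_geomRatio hσ h0 hU hW t X hX)

lemma lam_mono {b d BU BW Bx : ℝ} {ρ : ℝ≥0} (hBU : 0 ≤ BU) (hBW : 0 ≤ BW) (hBx : 0 ≤ Bx) :
    Monotone (lam b d ρ Bx BW (ρ * BU)) := fun s t hst =>
  min_le_min le_rfl (mul_le_mul_of_nonneg_left
    (geomRatio_mono (mul_nonneg ρ.2 hBU) hst) (by positivity))

/-- Stability of the hidden state in the weights: each step adds the error of the weights and
multiplies the error of the previous state by at most `ρh * BU`. -/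
lemma norm_hidden_sub_le (hσ : LipschitzWith ρh σh)
    {U U' : Matrix (Fin dh) (Fin dh) ℝ} {W W' : Matrix (Fin dh) (Fin dx) ℝ} {BU Bx H u w : ℝ}
    (hU : specNorm U ≤ BU) (hΔU : specNorm (U - U') ≤ u) (hΔW : specNorm (W - W') ≤ w) :
    ∀ (t : ℕ) (X : Fin t → EuclideanSpace ℝ (Fin dx)), (∀ i, ‖X i‖ ≤ Bx) →
      (∀ s (hs : s ≤ t), ‖hidden σh U' W' s (fun i => X (Fin.castLE hs i))‖ ≤ H) →
      ‖hidden σh U W t X - hidden σh U' W' t X‖ ≤ ρh * geomRatio (ρh * BU) t * (u * H + w * Bx)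
  | 0, _, _, _ => by simp [hidden, geomRatio_eq_sum]
  | t + 1, X, hX, hH => by
    have ih := norm_hidden_sub_le hσ hU hΔU hΔW t (fun i => X i.castSucc) (fun i => hX _)
      fun s hs => hH s (hs.trans t.le_succ)
    have hHt : ‖hidden σh U' W' t (fun i => X i.castSucc)‖ ≤ H := hH t t.le_succ
    set h := hidden σh U W t (fun i => X i.castSucc) with hh
    set h' := hidden σh U' W' t (fun i => X i.castSucc) with hh'
    have hu : 0 ≤ u := (specNorm_nonneg _).trans hΔU
    have hw : 0 ≤ w := (specNorm_nonneg _).trans hΔW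
    have hBU : 0 ≤ BU := (specNorm_nonneg _).trans hU
    have hx := hX (Fin.last t)
    set x := X (Fin.last t)
    have e0 := norm_entrywise_sub_le hσ (U *ᵥ h.ofLp + W *ᵥ x.ofLp) (U' *ᵥ h'.ofLp + W' *ᵥ x.ofLp)
    have hsplit : U *ᵥ h.ofLp + W *ᵥ x.ofLp - (U' *ᵥ h'.ofLp + W' *ᵥ x.ofLp)
        = U *ᵥ (h - h').ofLp + (U - U') *ᵥ h'.ofLp + (W - W') *ᵥ x.ofLp := by
      rw [WithLp.ofLp_sub, Matrix.mulVec_sub, Matrix.sub_mulVec, Matrix.sub_mulVec]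
      abel
    rw [hsplit] at e0
    have e1 : ‖(WithLp.toLp 2 (U *ᵥ (h - h').ofLp + (U - U') *ᵥ h'.ofLp + (W - W') *ᵥ x.ofLp) :
        EuclideanSpace ℝ (Fin dh))‖
        ≤ specNorm U * ‖h - h'‖ + specNorm (U - U') * ‖h'‖ + specNorm (W - W') * ‖x‖ :=
      norm_add₃_le.trans (add_le_add (add_le_add (norm_mulVec_le U (h - h'))
        (norm_mulVec_le (U - U') h')) (norm_mulVec_le (W - W') x))
    have e2 : specNorm U * ‖h - h'‖ ≤ BU * (ρh * geomRatio (ρh * BU) t * (u * H + w * Bx)) :=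
      mul_le_mul hU ih (norm_nonneg _) hBU
    have e3 : specNorm (U - U') * ‖h'‖ ≤ u * H := mul_le_mul hΔU hHt (norm_nonneg _) hu
    have e4 : specNorm (W - W') * ‖x‖ ≤ w * Bx := mul_le_mul hΔW hx (norm_nonneg _) hw
    rw [geomRatio_succ]
    calc _ ≤ _ := e0
      _ ≤ ρh * (BU * (ρh * geomRatio (ρh * BU) t * (u * H + w * Bx)) + u * H + w * Bx) :=
        mul_le_mul_of_nonneg_left (e1.trans (add_le_add (add_le_add e2 e3) e4)) ρh.2
      _ = _ := by ring

lemma norm_output_le (hσ : LipschitzWith ρy σy) (h0 : σy 0 = 0)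
    {U : Matrix (Fin dh) (Fin dh) ℝ} {V : Matrix (Fin K) (Fin dh) ℝ}
    {W : Matrix (Fin dh) (Fin dx) ℝ} {BV H : ℝ} (hV : specNorm V ≤ BV) {t : ℕ}
    {X : Fin t → EuclideanSpace ℝ (Fin dx)} (hH : ‖hidden σh U W t X‖ ≤ H) :
    ‖output σh σy U V W t X‖ ≤ ρy * BV * H := by
  have hBV : 0 ≤ BV := (specNorm_nonneg _).trans hV
  rw [mul_assoc]
  exact (norm_entrywise_le hσ h0 _).trans (mul_le_mul_of_nonneg_left
    ((norm_mulVec_le V _).trans (mul_le_mul hV hH (norm_nonneg _) hBV)) ρy.2)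

lemma norm_entrywise_mulVec_sub_le {σ : ℝ → ℝ} {ρ : ℝ≥0} (hσ : LipschitzWith ρ σ) {p q : ℕ}
    (V V' : Matrix (Fin p) (Fin q) ℝ) (h h' : EuclideanSpace ℝ (Fin q)) :
    ‖entrywise σ (V *ᵥ h.ofLp) - entrywise σ (V' *ᵥ h'.ofLp)‖
      ≤ ρ * (specNorm V * ‖h - h'‖ + specNorm (V - V') * ‖h'‖) := by
  have e0 := norm_entrywise_sub_le hσ (V *ᵥ h.ofLp) (V' *ᵥ h'.ofLp)
  have hsplit : V *ᵥ h.ofLp - V' *ᵥ h'.ofLp = V *ᵥ (h - h').ofLp + (V - V') *ᵥ h'.ofLp := by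
    rw [WithLp.ofLp_sub, Matrix.mulVec_sub, Matrix.sub_mulVec]
    abel
  rw [hsplit, WithLp.toLp_add] at e0
  exact e0.trans (mul_le_mul_of_nonneg_left ((norm_add_le _ _).trans
    (add_le_add (norm_mulVec_le V (h - h')) (norm_mulVec_le (V - V') h'))) ρ.2)

lemma norm_output_sub_le (hσ : LipschitzWith ρy σy)
    {U U' : Matrix (Fin dh) (Fin dh) ℝ} {V V' : Matrix (Fin K) (Fin dh) ℝ}
    {W W' : Matrix (Fin dh) (Fin dx) ℝ} {BV H v Δ : ℝ} (hV : specNorm V ≤ BV)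
    (hΔV : specNorm (V - V') ≤ v) {t : ℕ}
    {X : Fin t → EuclideanSpace ℝ (Fin dx)} (hH : ‖hidden σh U' W' t X‖ ≤ H)
    (hΔ : ‖hidden σh U W t X - hidden σh U' W' t X‖ ≤ Δ) :
    ‖output σh σy U V W t X - output σh σy U' V' W' t X‖ ≤ ρy * (BV * Δ + v * H) := by
  have hBV : 0 ≤ BV := (specNorm_nonneg _).trans hV
  have hv : 0 ≤ v := (specNorm_nonneg _).trans hΔV
  unfold output
  exact (norm_entrywise_mulVec_sub_le hσ V V' _ _).trans (mul_le_mul_of_nonneg_left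
    (add_le_add (mul_le_mul hV hΔ (norm_nonneg _) hBV) (mul_le_mul hΔV hH (norm_nonneg _) hv))
    ρy.2)

lemma continuous_entrywise {σ : ℝ → ℝ} (hσ : Continuous σ) {p : ℕ} {α : Type*}
    [TopologicalSpace α] {f : α → Fin p → ℝ} (hf : Continuous f) :
    Continuous fun a => entrywise σ (f a) :=
  (PiLp.continuous_toLp 2 _).comp (continuous_pi fun i => hσ.comp ((continuous_apply i).comp hf))

lemma continuous_hidden (hσ : Continuous σh)
    (U : Matrix (Fin dh) (Fin dh) ℝ) (W : Matrix (Fin dh) (Fin dx) ℝ) :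
    ∀ t : ℕ, Continuous (hidden σh U W t)
  | 0 => continuous_const
  | t + 1 => by
    have ih : Continuous fun X : Fin (t + 1) → EuclideanSpace ℝ (Fin dx) =>
        hidden σh U W t (fun i => X i.castSucc) :=
      (continuous_hidden hσ U W t).comp (by fun_prop)
    refine continuous_entrywise hσ (.add ?_ ?_)
    · exact Continuous.matrix_mulVec continuous_const ((PiLp.continuous_ofLp 2 _).comp ih)
    · exact Continuous.matrix_mulVec continuous_const
        ((PiLp.continuous_ofLp 2 _).comp (continuous_apply _))

lemma continuous_output (hσh : Continuous σh) (hσy : Continuous σy)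
    (U : Matrix (Fin dh) (Fin dh) ℝ) (V : Matrix (Fin K) (Fin dh) ℝ)
    (W : Matrix (Fin dh) (Fin dx) ℝ) (t : ℕ) : Continuous (output σh σy U V W t) :=
  continuous_entrywise hσy (Continuous.matrix_mulVec continuous_const
    ((PiLp.continuous_ofLp 2 _).comp (continuous_hidden hσh U W t)))

end

/-! ### Margins and the ramp loss -/

/-- The margin is `2`-Lipschitz in the output. -/
lemma margin_le_add {K : ℕ} (y y' : EuclideanSpace ℝ (Fin K)) (z : Fin K) :
    margin y z ≤ margin y' z + 2 * ‖y - y'‖ := by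
  have hc : ∀ j, |y j - y' j| ≤ ‖y - y'‖ := fun j => abs_coord_le_norm (y - y') j
  have hz := (abs_le.1 (hc z)).2
  have hsup : (⨆ j : {j : Fin K // j ≠ z}, y' j.1)
      ≤ (⨆ j : {j : Fin K // j ≠ z}, y j.1) + ‖y - y'‖ := by
    rcases isEmpty_or_nonempty {j : Fin K // j ≠ z} with h | h
    · -- both suprema are over the empty set, hence `0`
      simp
    · refine ciSup_le fun j => ?_
      have h1 := le_ciSup (f := fun j : {j : Fin K // j ≠ z} => y j.1) (Set.finite_range _).bddAbove j
      have h2 := (abs_le.1 (hc j.1)).1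
      simp only at h1
      linarith
  unfold margin
  linarith

lemma abs_margin_sub_le {K : ℕ} (y y' : EuclideanSpace ℝ (Fin K)) (z : Fin K) :
    |margin y z - margin y' z| ≤ 2 * ‖y - y'‖ := by
  have h1 := margin_le_add y y' z
  have h2 := margin_le_add y' y z
  rw [norm_sub_rev] at h2
  rw [abs_le]
  constructor <;> linarith

lemma margin_zero {K : ℕ} (z : Fin K) : margin (0 : EuclideanSpace ℝ (Fin K)) z = 0 := by
  simp [margin]

lemma margin_le_two_mul_norm {K : ℕ} (y : EuclideanSpace ℝ (Fin K)) (z : Fin K) :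
    margin y z ≤ 2 * ‖y‖ := by
  simpa [margin_zero] using margin_le_add y 0 z

lemma margin_nonpos_of_ne {K : ℕ} {y : EuclideanSpace ℝ (Fin K)} {z j : Fin K}
    (hj : ∀ i, y i ≤ y j) (hne : j ≠ z) : margin y z ≤ 0 := by
  have h1 := le_ciSup (f := fun j : {j : Fin K // j ≠ z} => y j.1) (Set.finite_range _).bddAbove
    ⟨j, hne⟩
  have := hj z
  simp only at h1
  unfold margin
  linarith

lemma continuous_margin {K : ℕ} (z : Fin K) :
    Continuous fun y : EuclideanSpace ℝ (Fin K) => margin y z := by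
  refine (LipschitzWith.of_dist_le_mul (K := 2) fun y y' => ?_).continuous
  rw [Real.dist_eq, dist_eq_norm]
  exact abs_margin_sub_le y y' z

lemma ramp_neg {γ : ℝ} (hγ : 0 < γ) (M : ℝ) : ramp γ (-M) = max 0 (min 1 (1 - M / γ)) := by
  unfold ramp
  rcases lt_or_ge M 0 with h | h
  · have h2 : M / γ ≤ 0 := div_nonpos_of_nonpos_of_nonneg h.le hγ.le
    rw [if_pos (by linarith), if_neg (by rintro ⟨-, h3⟩; linarith), min_eq_left (by linarith)]
    simp
  · rw [if_neg (by linarith), min_eq_right (by have := div_nonneg h hγ.le; linarith)]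
    rcases le_or_gt M γ with h3 | h3
    · have : M / γ ≤ 1 := (div_le_one hγ).2 h3
      rw [if_pos ⟨by linarith, by linarith⟩, max_eq_right (by linarith)]
      ring
    · have : 1 < M / γ := (one_lt_div hγ).2 h3
      rw [if_neg (by rintro ⟨h4, -⟩; linarith), max_eq_left (by linarith)]
      ring

lemma ramp_nonneg {γ : ℝ} (hγ : 0 < γ) (M : ℝ) : 0 ≤ ramp γ (-M) := by
  rw [ramp_neg hγ]; exact le_max_left _ _

lemma ramp_le_one {γ : ℝ} (hγ : 0 < γ) (M : ℝ) : ramp γ (-M) ≤ 1 := by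
  rw [ramp_neg hγ]; exact max_le zero_le_one (min_le_left _ _)

lemma ramp_eq_one {γ M : ℝ} (hγ : 0 < γ) (hM : M ≤ 0) : ramp γ (-M) = 1 := by
  have h2 : M / γ ≤ 0 := div_nonpos_of_nonpos_of_nonneg hM hγ.le
  rw [ramp_neg hγ, min_eq_left (by linarith), max_eq_right zero_le_one]

lemma ramp_mono {γ γ' : ℝ} (hγ' : 0 < γ') (h : γ' ≤ γ) (M : ℝ) :
    ramp γ' (-M) ≤ ramp γ (-M) := by
  rcases le_or_gt M 0 with hM | hM
  · rw [ramp_eq_one hγ' hM, ramp_eq_one (hγ'.trans_le h) hM]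
  · rw [ramp_neg hγ', ramp_neg (hγ'.trans_le h)]
    have : M / γ ≤ M / γ' := div_le_div_of_nonneg_left hM.le hγ' h
    gcongr

lemma ramp_le_add {γ : ℝ} (hγ : 0 < γ) (M M' : ℝ) :
    ramp γ (-M) ≤ ramp γ (-M') + |M - M'| / γ := by
  have h1 : M' / γ ≤ M / γ + |M - M'| / γ := by
    rw [← add_div]
    gcongr
    have := neg_abs_le (M - M')
    linarith
  have h2 : 0 ≤ |M - M'| / γ := by positivity
  rw [ramp_neg hγ, ramp_neg hγ]
  refine max_le (by positivity) ?_
  rcases le_total 1 (1 - M' / γ) with h | h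
  · rw [min_eq_left h]
    exact (min_le_left _ _).trans ((le_max_right 0 1).trans (by linarith))
  · rw [min_eq_right h]
    have := le_max_right 0 (1 - M' / γ)
    exact (min_le_right _ _).trans (by linarith)

/-- As long as the margin does not exceed `Λ ≤ γ`, the ramp loss is affine in `1 / γ`. -/
lemma ramp_eq_affine {γ Λ M : ℝ} (hΛ : 0 < Λ) (hγ : Λ ≤ γ) (hM : M ≤ Λ) :
    ramp γ (-M) = (1 - Λ / γ) + Λ / γ * ramp Λ (-M) := by
  have hγ0 : 0 < γ := hΛ.trans_le hγ
  rcases le_or_gt M 0 with h | h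
  · rw [ramp_eq_one hγ0 h, ramp_eq_one hΛ h]; ring
  · have h1 : 0 < M / γ := div_pos h hγ0
    have h2 : 0 < M / Λ := div_pos h hΛ
    have h3 : M / Λ ≤ 1 := (div_le_one hΛ).2 hM
    have h4 : M / γ ≤ 1 := (div_le_one hγ0).2 (hM.trans hγ)
    rw [ramp_neg hγ0, ramp_neg hΛ, min_eq_right (by linarith), min_eq_right (by linarith),
      max_eq_right (by linarith), max_eq_right (by linarith)]
    field_simp
    ring

lemma continuous_ramp_neg {γ : ℝ} (hγ : 0 < γ) : Continuous fun M => ramp γ (-M) := by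
  simp_rw [ramp_neg hγ]
  fun_prop

/-! ### Hoeffding's inequality for a finite family -/

section

variable {Ω : Type*} [MeasurableSpace Ω] (P : Measure Ω) [IsProbabilityMeasure P]

lemma hoeffding_mean_le {g : Ω → ℝ} (hg : Measurable g) (h01 : ∀ s, g s ∈ Set.Icc (0 : ℝ) 1)
    {m : ℕ} (hm : 0 < m) {τ : ℝ} (hτ : 0 ≤ τ) :
    (Measure.pi fun _ : Fin m => P).real
        {S | 1 / (m : ℝ) * ∑ i, g (S i) + τ ≤ ∫ s, g s ∂P} ≤ Real.exp (-2 * m * τ ^ 2) := by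
  have hm' : (0 : ℝ) < m := by exact_mod_cast hm
  set μ := Measure.pi fun _ : Fin m => P with hμ
  set c := ∫ s, g s ∂P with hc
  have hint : ∀ i : Fin m, ∫ S, -g (S i) ∂μ = -c := by
    intro i
    rw [integral_neg, hc, ← (measurePreserving_eval (fun _ : Fin m => P) i).map_eq,
      integral_map (measurable_pi_apply i).aemeasurable hg.aestronglyMeasurable]
  have hsub : ∀ i : Fin m, ProbabilityTheory.HasSubgaussianMGF (fun S : Fin m → Ω => c - g (S i))
      (1 / 4) μ := by
    intro i
    have h := ProbabilityTheory.hasSubgaussianMGF_of_mem_Icc (μ := μ) (a := -1) (b := 0)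
      (X := fun S : Fin m → Ω => -g (S i)) (hg.comp (measurable_pi_apply i)).neg.aemeasurable
      (ae_of_all _ fun S => ⟨by linarith [(h01 (S i)).2], by linarith [(h01 (S i)).1]⟩)
    rw [hint i] at h
    convert h using 1
    · ext S; ring
    · ext; norm_num
  have hind : ProbabilityTheory.iIndepFun (fun (i : Fin m) (S : Fin m → Ω) => c - g (S i)) μ :=
    ProbabilityTheory.iIndepFun_pi (μ := fun _ : Fin m => P) (X := fun _ s => c - g s)
      fun _ => (hg.const_sub c).aemeasurable
  have h := ProbabilityTheory.HasSubgaussianMGF.measure_sum_ge_le_of_iIndepFun hind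
    (s := Finset.univ) (fun i _ => hsub i) (ε := m * τ) (by positivity)
  refine le_trans (le_of_eq ?_) (h.trans (le_of_eq ?_))
  · congr 1
    ext S
    simp only [Set.mem_ofPred_eq, Finset.sum_sub_distrib, Finset.sum_const, Finset.card_univ,
      Fintype.card_fin, nsmul_eq_mul]
    constructor <;> intro hS
    · have := mul_le_mul_of_nonneg_left hS hm'.le
      rw [mul_add, ← mul_assoc, mul_one_div_cancel hm'.ne', one_mul] at this
      linarith
    · refine le_of_mul_le_mul_left ?_ hm'
      rw [mul_add, ← mul_assoc, mul_one_div_cancel hm'.ne', one_mul]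
      linarith
  · congr 1
    simp
    field_simp
    ring

/-- Simultaneous one-sided deviation bound for a finite family of `[0, 1]`-valued functions. -/
lemma measure_exists_deviation_le {J : Type*} [Fintype J] {g : J → Ω → ℝ}
    (hg : ∀ j, Measurable (g j)) (h01 : ∀ j s, g j s ∈ Set.Icc (0 : ℝ) 1)
    {m : ℕ} (hm : 0 < m) {N δ : ℝ} (hδ : 0 < δ) (hN : Fintype.card J ≤ N) (hδN : δ ≤ N) :
    (Measure.pi fun _ : Fin m => P)
        {S | ∃ j, 1 / (m : ℝ) * ∑ i, g j (S i) + √(Real.log (N / δ) / (2 * m)) ≤ ∫ s, g j s ∂P}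
      ≤ ENNReal.ofReal δ := by
  have hm' : (0 : ℝ) < m := by exact_mod_cast hm
  have hN0 : 0 < N := hδ.trans_le hδN
  have hexp : Real.exp (-2 * m * √(Real.log (N / δ) / (2 * m)) ^ 2) = δ / N := by
    have hlog : 0 ≤ Real.log (N / δ) := Real.log_nonneg ((one_le_div hδ).2 hδN)
    rw [Real.sq_sqrt (by positivity)]
    have : -2 * (m : ℝ) * (Real.log (N / δ) / (2 * m)) = -Real.log (N / δ) := by field_simp
    rw [this, Real.exp_neg, Real.exp_log (by positivity), inv_div]
  rw [Set.ofPred_exists]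
  refine (measure_iUnion_fintype_le _ _).trans ?_
  calc _ ≤ ∑ _j : J, ENNReal.ofReal (δ / N) := by
        refine Finset.sum_le_sum fun j _ => ?_
        have h := hoeffding_mean_le P (hg j) (h01 j) hm
          (Real.sqrt_nonneg (Real.log (N / δ) / (2 * m)))
        rw [hexp] at h
        rw [← ofReal_measureReal]
        exact ENNReal.ofReal_le_ofReal h
    _ = ENNReal.ofReal (Fintype.card J * (δ / N)) := by
        rw [Finset.sum_const, Finset.card_univ, nsmul_eq_mul, ENNReal.ofReal_mul (by positivity),
          ENNReal.ofReal_natCast]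
    _ ≤ _ := by
        refine ENNReal.ofReal_le_ofReal ?_
        calc _ ≤ N * (δ / N) := by gcongr
          _ = δ := by field_simp

/-! ### From a finite net of margins to all margins and all scales -/

variable {P}
variable {A err : Set Ω} {m : ℕ} {S : Fin m → Ω} {M M' : Ω → ℝ} {Λ ε τ γ : ℝ}

/-- Error bound at a fixed scale `γ`, for a margin function `M` that is `η`-close to an `M'` whose
ramp loss does not deviate by more than `τ`. -/
lemma measureReal_error_le_of_close (hm : 0 < m) (hγ : 0 < γ) {η : ℝ} (hM' : Measurable M')
    (hA : ∀ᵐ s ∂P, s ∈ A) (hS : ∀ i, S i ∈ A) (hclose : ∀ s ∈ A, |M s - M' s| ≤ η)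
    (hdev : ∫ s, ramp γ (-M' s) ∂P ≤ 1 / (m : ℝ) * ∑ i, ramp γ (-M' (S i)) + τ)
    (herr : ∀ s ∈ err, M s ≤ 0) :
    P.real err ≤ 1 / (m : ℝ) * ∑ i, ramp γ (-M (S i)) + τ + 2 * (η / γ) := by
  have hm' : (0 : ℝ) < m := by exact_mod_cast hm
  have hη : 0 ≤ η := (abs_nonneg _).trans (hclose _ (hS ⟨0, hm⟩))
  have hmeas : Measurable fun s => ramp γ (-M' s) := (continuous_ramp_neg hγ).measurable.comp hM'
  have hint : Integrable (fun s => ramp γ (-M' s)) P :=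
    Integrable.of_mem_Icc 0 1 hmeas.aemeasurable
      (ae_of_all _ fun s => ⟨ramp_nonneg hγ _, ramp_le_one hγ _⟩)
  have hint2 : Integrable (fun s => ramp γ (-M' s) + η / γ) P := hint.add (integrable_const _)
  have h1 : P.real err ≤ P.real {s | 1 ≤ ramp γ (-M' s) + η / γ} := by
    -- `err` need not be measurable; it is contained, up to a null set, in a measurable set
    refine ENNReal.toReal_mono (measure_ne_top _ _) (measure_mono_ae ?_)
    filter_upwards [hA] with s hs hse
    have h := ramp_le_add hγ (M s) (M' s)
    rw [ramp_eq_one hγ (herr s hse)] at h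
    have := div_le_div_of_nonneg_right (hclose s hs) hγ.le
    change 1 ≤ ramp γ (-M' s) + η / γ
    linarith
  have h2 := mul_meas_ge_le_integral_of_nonneg
    (ae_of_all P fun s => add_nonneg (ramp_nonneg hγ (M' s)) (div_nonneg hη hγ.le)) hint2 1
  rw [integral_add hint (integrable_const _), integral_const] at h2
  simp only [probReal_univ, one_smul, one_mul] at h2
  have h3 : 1 / (m : ℝ) * ∑ i, ramp γ (-M' (S i))
      ≤ 1 / (m : ℝ) * ∑ i, ramp γ (-M (S i)) + η / γ := by
    calc _ ≤ 1 / (m : ℝ) * ∑ i, (ramp γ (-M (S i)) + η / γ) := by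
          gcongr with i
          refine (ramp_le_add hγ (M' (S i)) (M (S i))).trans ?_
          rw [abs_sub_comm]
          gcongr
          exact hclose _ (hS i)
      _ = _ := by
          rw [Finset.sum_add_distrib, mul_add]
          simp
          field_simp
  linarith

/-- Error bound for all scales at once. Only the scales `Λ / k` with `k = 1, …, m` have to be
controlled: for `γ ≤ Λ` the next smaller of them is within a factor `2` of `γ`, and for `γ > Λ`
the ramp loss is affine in `1 / γ`. -/
lemma measureReal_error_le_of_grid (hm : 0 < m) (hΛ : 0 < Λ) (hγ : 0 < γ) (hγm : Λ / γ ≤ m)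
    (hM' : Measurable M') (hA : ∀ᵐ s ∂P, s ∈ A) (hS : ∀ i, S i ∈ A) (hMΛ : ∀ s ∈ A, M s ≤ Λ)
    (hclose : ∀ s ∈ A, |M s - M' s| ≤ ε * Λ)
    (hdev : ∀ k : Fin m, ∫ s, ramp (Λ / (k.1 + 1 : ℕ)) (-M' s) ∂P
      ≤ 1 / (m : ℝ) * ∑ i, ramp (Λ / (k.1 + 1 : ℕ)) (-M' (S i)) + τ)
    (herr : ∀ s ∈ err, M s ≤ 0) :
    P.real err ≤ 1 / (m : ℝ) * ∑ i, ramp γ (-M (S i)) + min 1 (Λ / γ) * τ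
      + 4 * ε * (Λ / γ) := by
  have hm' : (0 : ℝ) < m := by exact_mod_cast hm
  have hε : 0 ≤ ε := by
    have := (abs_nonneg _).trans (hclose _ (hS ⟨0, hm⟩))
    exact nonneg_of_mul_nonneg_left this hΛ
  have hstep : ∀ k : Fin m, P.real err ≤ 1 / (m : ℝ) * ∑ i, ramp (Λ / (k.1 + 1 : ℕ)) (-M (S i))
      + τ + 2 * (ε * (k.1 + 1 : ℕ)) := by
    intro k
    have h := measureReal_error_le_of_close hm (by positivity) hM' hA hS hclose (hdev k) herr
    have : ε * Λ / (Λ / (k.1 + 1 : ℕ)) = ε * (k.1 + 1 : ℕ) := by field_simp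
    rwa [this] at h
  rcases le_or_gt γ Λ with hle | hlt
  · have h1 : 1 ≤ Λ / γ := (one_le_div hγ).2 hle
    obtain ⟨k, hk⟩ : ∃ k, ⌈Λ / γ⌉₊ = k + 1 :=
      Nat.exists_eq_succ_of_ne_zero (Nat.ceil_pos.2 (by linarith)).ne'
    have hkm : k < m := by
      have : ⌈Λ / γ⌉₊ ≤ m := Nat.ceil_le.2 hγm
      omega
    have hk1 : Λ / γ ≤ (k + 1 : ℕ) := by rw [← hk]; exact Nat.le_ceil _
    have hk2 : ((k + 1 : ℕ) : ℝ) ≤ 2 * (Λ / γ) := by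
      have := Nat.ceil_lt_add_one (zero_le_one.trans h1)
      rw [hk] at this
      linarith
    have hγk : Λ / (k + 1 : ℕ) ≤ γ := by
      rw [div_le_iff₀ (by positivity), mul_comm]
      exact (div_le_iff₀ hγ).1 hk1
    have h := hstep ⟨k, hkm⟩
    have hmono : 1 / (m : ℝ) * ∑ i, ramp (Λ / (k + 1 : ℕ)) (-M (S i))
        ≤ 1 / (m : ℝ) * ∑ i, ramp γ (-M (S i)) := by
      gcongr with i
      exact ramp_mono (by positivity) hγk _
    have := mul_le_mul_of_nonneg_left hk2 hε
    rw [min_eq_left h1]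
    simp only at h
    linarith
  · have h1 : Λ / γ ≤ 1 := (div_le_one hγ).2 hlt.le
    have h0 : 0 < Λ / γ := by positivity
    have h := hstep ⟨0, hm⟩
    simp only [zero_add, Nat.cast_one, div_one, mul_one] at h
    have haff : 1 / (m : ℝ) * ∑ i, ramp γ (-M (S i))
        = (1 - Λ / γ) + Λ / γ * (1 / (m : ℝ) * ∑ i, ramp Λ (-M (S i))) := by
      rw [Finset.sum_congr rfl fun i _ => ramp_eq_affine hΛ hlt.le (hMΛ _ (hS i)),
        Finset.sum_add_distrib, ← Finset.mul_sum]
      simp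
      field_simp
    have hp : P.real err ≤ 1 := measureReal_le_one
    rw [min_eq_right h1, haff]
    have h3 := mul_le_mul_of_nonneg_left h h0.le
    have h4 := mul_le_mul_of_nonneg_left hp (sub_nonneg.2 h1)
    have h5 : 0 ≤ ε * (Λ / γ) := by positivity
    nlinarith

end

/-! ### A finite net of the network class -/

lemma effDim_eq_sqrt_natCast (dx dh K : ℕ) :
    effDim dx dh K = √((dx * dh + dh ^ 2 + dh * K : ℕ) : ℝ) := by
  unfold effDim
  push_cast
  rfl

lemma lam_nonneg {b d ρ Bx BW β : ℝ} (hb : 0 ≤ b) (hρ : 0 ≤ ρ) (hBx : 0 ≤ Bx) (hBW : 0 ≤ BW)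
    (hβ : 0 ≤ β) (t : ℕ) : 0 ≤ lam b d ρ Bx BW β t := by
  have := geomRatio_nonneg hβ t
  exact le_min (by positivity) (by positivity)

/-- The second term in the minimum defining `lam` exceeds `lam` by a controlled factor. -/
lemma mul_geomRatio_le_lam_mul {b d ρ Bx BW β : ℝ} (hb : 0 < b) (hd : 1 ≤ d) (hρ : 0 ≤ ρ)
    (hBx : 0 ≤ Bx) (hBW : 0 ≤ BW) (hβ : 0 ≤ β) (t : ℕ) :
    ρ * Bx * BW * geomRatio β t
      ≤ lam b d ρ Bx BW β t * (1 + ρ * Bx * BW / b * geomRatio β t) := by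
  have hG := geomRatio_nonneg hβ t
  have hd' : 1 ≤ √d := Real.one_le_sqrt.2 hd
  unfold lam
  rcases min_choice (b * √d) (ρ * Bx * BW * geomRatio β t) with h | h <;> rw [h]
  · have h0 : 0 ≤ ρ * Bx * BW * geomRatio β t := by positivity
    have h1 : b * √d * (1 + ρ * Bx * BW / b * geomRatio β t)
        = b * √d + √d * (ρ * Bx * BW * geomRatio β t) := by field_simp
    rw [h1]
    have := mul_le_mul_of_nonneg_right hd' h0
    have : 0 ≤ b * √d := by positivity
    linarith
  · exact le_mul_of_one_le_right (by positivity) (le_add_of_nonneg_right (by positivity))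

/-- A finite net of weights, with as many parameters as `effDim ^ 2`, such that every network of the
class has a member of the net whose outputs are uniformly close to its own. The error is stated
relative to the bound `ρy * BV * lam` on the size of the outputs. -/
lemma exists_net_output {σh σy : ℝ → ℝ} {ρh ρy : ℝ≥0} {dx dh K n t : ℕ} {b Bx BU BV BW : ℝ}
    (hb : 0 < b) (hBx : 0 ≤ Bx) (hBU : 0 ≤ BU) (hBV : 0 ≤ BV) (hBW : 0 ≤ BW)
    (hσh : LipschitzWith ρh σh) (hσy : LipschitzWith ρy σy) (h0 : σh 0 = 0)
    (hσb : ∀ v, |σh v| ≤ b) (hd : 1 ≤ effDim dx dh K) (hG : 1 ≤ geomRatio (ρh * BU) t)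
    (hn : 0 < n) :
    ∃ F : Finset (Matrix (Fin dh) (Fin dh) ℝ × Matrix (Fin K) (Fin dh) ℝ
        × Matrix (Fin dh) (Fin dx) ℝ),
      F.card ≤ (2 * n + 1) ^ (dx * dh + dh ^ 2 + dh * K) ∧
      ∀ (U : Matrix (Fin dh) (Fin dh) ℝ) (V : Matrix (Fin K) (Fin dh) ℝ)
        (W : Matrix (Fin dh) (Fin dx) ℝ), specNorm U ≤ BU → specNorm V ≤ BV → specNorm W ≤ BW →
        ∃ θ ∈ F, ∀ X : Fin t → EuclideanSpace ℝ (Fin dx), (∀ i, ‖X i‖ ≤ Bx) →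
          ‖output σh σy U V W t X - output σh σy θ.1 θ.2.1 θ.2.2 t X‖
            ≤ ρy * BV * lam b (effDim dx dh K) ρh Bx BW (ρh * BU) t
              * (effDim dx dh K * (ρh * BU + 2 + ρh * Bx * BW / b) * geomRatio (ρh * BU) t
                / n) := by
  have hn' : (0 : ℝ) < n := by exact_mod_cast hn
  obtain ⟨FU, hFU, hcU, hU⟩ := exists_net_specNorm_ball dh dh hBU hn
  obtain ⟨FV, hFV, hcV, hV⟩ := exists_net_specNorm_ball K dh hBV hn
  obtain ⟨FW, hFW, hcW, hW⟩ := exists_net_specNorm_ball dh dx hBW hn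
  refine ⟨FU ×ˢ FV ×ˢ FW, ?_, fun U V W hUB hVB hWB => ?_⟩
  · rw [Finset.card_product, Finset.card_product]
    calc _ ≤ (2 * n + 1) ^ (dh * dh) * ((2 * n + 1) ^ (K * dh) * (2 * n + 1) ^ (dh * dx)) := by
          gcongr
      _ = _ := by rw [← pow_add, ← pow_add]; congr 1; ring
  obtain ⟨U', hU', hΔU⟩ := hU U hUB
  obtain ⟨V', hV', hΔV⟩ := hV V hVB
  obtain ⟨W', hW', hΔW⟩ := hW W hWB
  refine ⟨(U', V', W'), by simp [hU', hV', hW'], fun X hX => ?_⟩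
  simp only
  set d := effDim dx dh K with hd_def
  set β := (ρh : ℝ) * BU with hβ_def
  have hβ : 0 ≤ β := mul_nonneg ρh.coe_nonneg hBU
  set G := geomRatio β t with hG_def
  set l := lam b d ρh Bx BW β t with hl
  have hl0 : 0 ≤ l := lam_nonneg hb.le ρh.coe_nonneg hBx hBW hβ t
  have hdU : √((dh : ℝ) * dh) ≤ d := by
    refine Real.sqrt_le_sqrt ?_
    have : (0 : ℝ) ≤ (dx : ℝ) * dh := by positivity
    have : (0 : ℝ) ≤ (dh : ℝ) * K := by positivity
    nlinarith
  have hdV : √((K : ℝ) * dh) ≤ d := by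
    refine Real.sqrt_le_sqrt ?_
    have : (0 : ℝ) ≤ (dx : ℝ) * dh := by positivity
    nlinarith
  have hdW : √((dh : ℝ) * dx) ≤ d := by
    refine Real.sqrt_le_sqrt ?_
    have : (0 : ℝ) ≤ (dh : ℝ) * K := by positivity
    nlinarith
  have hΔU' : specNorm (U - U') ≤ d * (BU / n) := hΔU.trans (by gcongr)
  have hΔV' : specNorm (V - V') ≤ d * (BV / n) := hΔV.trans (by gcongr)
  have hΔW' : specNorm (W - W') ≤ d * (BW / n) := hΔW.trans (by gcongr)
  have hH : ∀ s (hs : s ≤ t), ‖hidden σh U' W' s (fun i => X (Fin.castLE hs i))‖ ≤ l :=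
    fun s hs => (norm_hidden_le_lam hb.le hσh h0 hσb (hFU U' hU') (hFW W' hW') K s _
      fun i => hX _).trans (lam_mono hBU hBW hBx hs)
  have hΔ := norm_hidden_sub_le hσh hUB hΔU' hΔW' t X hX hH
  have hout := norm_output_sub_le (σh := σh) hσy hVB hΔV' (hH t le_rfl) hΔ
  refine hout.trans ?_
  have hkey := mul_geomRatio_le_lam_mul hb hd ρh.coe_nonneg hBx hBW hβ t
  rw [← hl, ← hG_def] at hkey
  have hlG : l ≤ l * G := le_mul_of_one_le_right hl0 hG
  have hmain : β * G * l + ρh * Bx * BW * G + l ≤ l * ((β + 2 + ρh * Bx * BW / b) * G) := by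
    linarith
  calc (ρy : ℝ) * (BV * (ρh * G * (d * (BU / n) * l + d * (BW / n) * Bx)) + d * (BV / n) * l)
      = ρy * BV * (d / n) * (β * G * l + ρh * Bx * BW * G + l) := by
        rw [hβ_def]; field_simp
    _ ≤ ρy * BV * (d / n) * (l * ((β + 2 + ρh * Bx * BW / b) * G)) := by gcongr
    _ = _ := by ring

/-! ### Size of the logarithmic term -/

/-- The union bound over the net, the `m` scales and the time steps only costs a constant multiple
of `d ^ 2 * log (t √(d m) G)`. -/
lemma log_union_le {D n m t : ℕ} {A G : ℝ} (hD : 2 ≤ D) (hA : 2 ≤ A) (hG : 1 ≤ G) (ht : 1 ≤ t)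
    (hm : 9 ≤ m) (hmA : 36 * A ^ 2 ≤ m) (hn : (n : ℝ) ≤ √D * A * G * √m + 1) :
    1 ≤ Real.log (t * √(√D * m) * G) ∧
    Real.log (((2 * n + 1) ^ D * m : ℕ) * (t * (t + 1)))
      ≤ 4 * √D ^ 2 * Real.log (t * √(√D * m) * G) := by
  set d := √(D : ℝ) with hd_def
  have hm' : (9 : ℝ) ≤ m := by exact_mod_cast hm
  have ht' : (1 : ℝ) ≤ t := by exact_mod_cast ht
  have hD' : (2 : ℝ) ≤ D := by exact_mod_cast hD
  have hd : 1 ≤ d := Real.one_le_sqrt.2 (by linarith)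
  have hd2 : d ^ 2 = D := Real.sq_sqrt (by positivity)
  set Q := (t : ℝ) * √(d * m) * G with hQ
  have hm3 : 3 ≤ √(m : ℝ) := Real.le_sqrt_of_sq_le (by linarith)
  have hmA' : 6 * A ≤ √(m : ℝ) := Real.le_sqrt_of_sq_le (by nlinarith)
  have hmm : √(m : ℝ) * √m = m := Real.mul_self_sqrt (by positivity)
  have hQ3 : 3 ≤ Q := by
    have h1 : √(m : ℝ) ≤ √(d * m) :=
      Real.sqrt_le_sqrt (le_mul_of_one_le_left (by positivity) hd)
    have h2 : √(d * m) ≤ t * √(d * m) := le_mul_of_one_le_left (by positivity) ht'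
    have h3 : t * √(d * m) ≤ Q := le_mul_of_one_le_right (by positivity) hG
    linarith
  have hL1 : 1 ≤ Real.log Q := by
    rw [Real.le_log_iff_exp_le (by linarith)]
    linarith [Real.exp_one_lt_d9]
  refine ⟨hL1, ?_⟩
  have hQ2 : Q ^ 2 = t ^ 2 * (d * m) * G ^ 2 := by
    rw [hQ, mul_pow, mul_pow, Real.sq_sqrt (by positivity)]
  have ht2 : (1 : ℝ) ≤ t ^ 2 := one_le_pow₀ ht'
  have hG2 : G ≤ G ^ 2 := by nlinarith
  have hG21 : 1 ≤ G ^ 2 := one_le_pow₀ hG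
  have hdm : (m : ℝ) ≤ d * m := le_mul_of_one_le_left (by positivity) hd
  have hb1 : (2 * n + 1 : ℝ) ≤ Q ^ 2 := by
    have h1 : 3 ≤ d * A * G * √m := by
      have : 1 ≤ d * A * G := one_le_mul_of_one_le_of_one_le
        (one_le_mul_of_one_le_of_one_le hd (by linarith)) hG
      nlinarith
    have h2 : d * A * G * √m * 3 ≤ d * m * G := by
      have : A * 3 ≤ √(m : ℝ) := by linarith
      calc d * A * G * √m * 3 = d * G * √m * (A * 3) := by ring
        _ ≤ d * G * √m * √m := by gcongr
        _ = d * m * G := by rw [mul_assoc, hmm]; ring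
    calc (2 * n + 1 : ℝ) ≤ d * A * G * √m * 3 := by linarith
      _ ≤ d * m * G := h2
      _ ≤ d * m * G ^ 2 := by gcongr
      _ ≤ t ^ 2 * (d * m * G ^ 2) := le_mul_of_one_le_left (by positivity) ht2
      _ = Q ^ 2 := by rw [hQ2]; ring
  have hb2 : (m : ℝ) ≤ Q ^ 2 := by
    calc (m : ℝ) ≤ d * m := hdm
      _ ≤ d * m * G ^ 2 := le_mul_of_one_le_right (by positivity) hG21
      _ ≤ t ^ 2 * (d * m * G ^ 2) := le_mul_of_one_le_left (by positivity) ht2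
      _ = Q ^ 2 := by rw [hQ2]; ring
  have hb3 : (t : ℝ) * (t + 1) ≤ Q ^ 2 := by
    calc (t : ℝ) * (t + 1) ≤ t ^ 2 * 2 := by nlinarith
      _ ≤ t ^ 2 * (d * m) := by gcongr; linarith
      _ ≤ t ^ 2 * (d * m) * G ^ 2 := le_mul_of_one_le_right (by positivity) hG21
      _ = Q ^ 2 := hQ2.symm
  have hprod : (((2 * n + 1) ^ D * m : ℕ) : ℝ) * (t * (t + 1)) ≤ Q ^ (2 * D + 4) := by
    push_cast
    calc ((2 * n + 1 : ℝ) ^ D * m) * (t * (t + 1)) ≤ (Q ^ 2) ^ D * Q ^ 2 * Q ^ 2 := by gcongr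
      _ = _ := by ring
  calc _ ≤ Real.log (Q ^ (2 * D + 4)) := by
        refine Real.log_le_log ?_ hprod
        have : (0 : ℝ) < m := by linarith
        push_cast
        positivity
    _ = (2 * D + 4) * Real.log Q := by rw [Real.log_pow]; push_cast; ring
    _ ≤ 4 * d ^ 2 * Real.log Q := by
        rw [hd2]
        gcongr
        linarith

/-- The deviation term with its union bound splits into the confidence term and a multiple of the
complexity term. -/
lemma deviation_add_le {m : ℕ} (hm : 0 < m) {N δ d L θ : ℝ} (hN : 0 < N) (hδ : 0 < δ)
    (hδ1 : δ < 1) (hd : 1 ≤ d) (hL : 1 ≤ L) (hNL : Real.log N ≤ 4 * d ^ 2 * L) (hθ : 0 ≤ θ) :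
    min 1 θ * √(Real.log (N / δ) / (2 * m)) + 4 * (1 / √m) * θ
      ≤ 3 * √(Real.log (2 / δ) / (2 * m)) + 6 * (d * θ * √L / √m) := by
  have hm' : (0 : ℝ) < m := by exact_mod_cast hm
  have h2δ : 0 ≤ Real.log (2 / δ) := Real.log_nonneg ((one_le_div hδ).2 (by linarith))
  have hlog : Real.log (N / δ) ≤ Real.log (2 / δ) + 4 * d ^ 2 * L := by
    rw [Real.log_div hN.ne' hδ.ne', Real.log_div two_ne_zero hδ.ne']
    have := Real.log_nonneg one_le_two
    linarith
  have hs : √(Real.log (N / δ) / (2 * m)) ≤ √(Real.log (2 / δ) / (2 * m)) + 2 * (d * √L / √m) := by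
    calc _ ≤ √(Real.log (2 / δ) / (2 * m) + (2 * (d * √L / √m)) ^ 2) := by
          refine Real.sqrt_le_sqrt ?_
          have : (2 * (d * √L / √m)) ^ 2 = 4 * d ^ 2 * L / m := by
            rw [mul_pow, div_pow, mul_pow, Real.sq_sqrt (by linarith), Real.sq_sqrt hm'.le]
            ring
          rw [this]
          have h3 : 4 * d ^ 2 * L / (2 * m) ≤ 4 * d ^ 2 * L / m := by
            gcongr
            linarith
          calc _ ≤ (Real.log (2 / δ) + 4 * d ^ 2 * L) / (2 * m) := by gcongr
            _ = Real.log (2 / δ) / (2 * m) + 4 * d ^ 2 * L / (2 * m) := add_div _ _ _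
            _ ≤ _ := by linarith
      _ ≤ _ := by
          refine Real.sqrt_le_iff.2 ⟨by positivity, ?_⟩
          have h1 := Real.sq_sqrt (div_nonneg h2δ (by positivity : (0 : ℝ) ≤ 2 * m))
          have h2 : 0 ≤ √(Real.log (2 / δ) / (2 * m)) * (2 * (d * √L / √m)) := by positivity
          linarith [add_sq (√(Real.log (2 / δ) / (2 * m))) (2 * (d * √L / √m))]
  have hdL : 1 ≤ d * √L := one_le_mul_of_one_le_of_one_le hd (Real.one_le_sqrt.2 hL)
  have h4 : 4 * (1 / √m) * θ ≤ 4 * (d * θ * √L / √m) := by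
    have : 1 / √(m : ℝ) * θ ≤ d * √L / √m * θ := by gcongr
    calc _ = 4 * (1 / √m * θ) := by ring
      _ ≤ 4 * (d * √L / √m * θ) := by linarith
      _ = _ := by ring
  have h5 : min 1 θ * √(Real.log (N / δ) / (2 * m))
      ≤ √(Real.log (2 / δ) / (2 * m)) + 2 * (d * θ * √L / √m) := by
    calc _ ≤ min 1 θ * (√(Real.log (2 / δ) / (2 * m)) + 2 * (d * √L / √m)) :=
          mul_le_mul_of_nonneg_left hs (le_min zero_le_one hθ)
      _ = min 1 θ * √(Real.log (2 / δ) / (2 * m)) + min 1 θ * (2 * (d * √L / √m)) := mul_add _ _ _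
      _ ≤ 1 * √(Real.log (2 / δ) / (2 * m)) + θ * (2 * (d * √L / √m)) := by
          gcongr
          · exact min_le_left _ _
          · exact min_le_right _ _
      _ = _ := by ring
  have := Real.sqrt_nonneg (Real.log (2 / δ) / (2 * m))
  linarith

lemma complexityTerm_eq (d ρh ρy b Bx BU BV BW : ℝ) (m t : ℕ) (γ : ℝ) :
    complexityTerm d ρh ρy b Bx BU BV BW m t γ
      = d * (ρy * BV * lam b d ρh Bx BW (ρh * BU) t / γ)
        * √(Real.log (t * √(d * m) * geomRatio (ρh * BU) t)) / √m := by
  unfold complexityTerm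
  ring

/-! ### The bound at one time step -/

section

variable {σh σy : ℝ → ℝ} {ρh ρy : ℝ≥0} {dx dh K T : ℕ} {b Bx BU BV BW : ℝ}

lemma measurable_margin_output (hσh : Continuous σh) (hσy : Continuous σy)
    (U : Matrix (Fin dh) (Fin dh) ℝ) (V : Matrix (Fin K) (Fin dh) ℝ)
    (W : Matrix (Fin dh) (Fin dx) ℝ) (t : Fin T) :
    Measurable fun s : LabelledSeq dx K T =>
      margin (output σh σy U V W (t.val + 1) (inputs s t)) (label s t) := by
  have hmargin : Measurable fun p : EuclideanSpace ℝ (Fin K) × Fin K => margin p.1 p.2 :=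
    measurable_from_prod_countable_left fun z => (continuous_margin z).measurable
  have hinputs : Measurable fun s : LabelledSeq dx K T => inputs s t :=
    measurable_pi_lambda _ fun i => (measurable_pi_apply (Fin.castLE t.isLt i)).fst
  have hlabel : Measurable fun s : LabelledSeq dx K T => label s t :=
    (measurable_pi_apply t).snd
  exact hmargin.comp
    (((continuous_output hσh hσy U V W (t.val + 1)).measurable.comp hinputs).prodMk hlabel)

lemma empRampRisk_eq_one_of_output_eq_zero {m : ℕ} (hm : 0 < m) {γ : ℝ} (hγ : 0 < γ)
    {S : Fin m → LabelledSeq dx K T} {t : Fin T}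
    {f : (Fin (t.val + 1) → EuclideanSpace ℝ (Fin dx)) → EuclideanSpace ℝ (Fin K)}
    (hf : ∀ i, f (inputs (S i) t) = 0) : empRampRisk γ S t f = 1 := by
  have hm' : (m : ℝ) ≠ 0 := by exact_mod_cast hm.ne'
  unfold empRampRisk
  rw [Finset.sum_congr rfl fun i _ => by rw [hf i, ramp_eq_one hγ (margin_zero _).le]]
  simp [hm']

/-- The generalization bound at a single time step, with a failure probability that is summable
over the time steps. -/
lemma measure_bad_at_time_le (hb : 0 ≤ b) (hBx : 0 ≤ Bx) (hBU : 0 ≤ BU) (hBV : 0 ≤ BV)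
    (hBW : 0 ≤ BW) (hσh : LipschitzWith ρh σh) (hσy : LipschitzWith ρy σy) (h0 : σh 0 = 0)
    (h0y : σy 0 = 0) (hσb : ∀ v, |σh v| ≤ b) (P : Measure (LabelledSeq dx K T))
    [IsProbabilityMeasure P] (hP : ∀ᵐ s ∂P, ∀ t, ‖(s t).1‖ ≤ Bx)
    {φ : EuclideanSpace ℝ (Fin K) → Fin K}
    (hφ : ∀ (y : EuclideanSpace ℝ (Fin K)) (j : Fin K), y j ≤ y (φ y)) {m : ℕ} (hm : 9 ≤ m)
    (hmA : 36 * ((ρh : ℝ) * BU + 2 + ρh * Bx * BW / b) ^ 2 ≤ m) {δ : ℝ} (hδ : 0 < δ)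
    (hδ1 : δ < 1) (t : Fin T) :
    (Measure.pi fun _ : Fin m => P)
      {S | (∀ i t, ‖(S i t).1‖ ≤ Bx) ∧ ¬ ∀ γ : ℝ, 0 < γ →
        ∀ f ∈ rnnClass σh σy dx dh K BU BV BW (t.val + 1),
          misclass P φ t f ≤ empRampRisk γ S t f + 3 * √(Real.log (2 / δ) / (2 * (m : ℝ)))
            + 12 * complexityTerm (effDim dx dh K) ρh ρy b Bx BU BV BW m (t.val + 1) γ}
      ≤ ENNReal.ofReal (δ / ((t.val + 1) * (t.val + 2))) := by
  have hm0 : 0 < m := by omega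
  have hm' : (9 : ℝ) ≤ m := by exact_mod_cast hm
  set d := effDim dx dh K with hd_def
  set β := (ρh : ℝ) * BU with hβ_def
  have hβ : 0 ≤ β := mul_nonneg ρh.coe_nonneg hBU
  set l := lam b d ρh Bx BW β (t.val + 1) with hl
  have hl0 : 0 ≤ l := lam_nonneg hb ρh.coe_nonneg hBx hBW hβ _
  have hd0 : 0 ≤ d := Real.sqrt_nonneg _
  have hc : ∀ γ : ℝ, 0 < γ → 0 ≤ complexityTerm d ρh ρy b Bx BU BV BW m (t.val + 1) γ := by
    intro γ hγ
    rw [complexityTerm_eq, ← hβ_def, ← hl]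
    positivity
  have hinputs : ∀ {s : LabelledSeq dx K T}, (∀ t, ‖(s t).1‖ ≤ Bx) → ∀ i, ‖inputs s t i‖ ≤ Bx :=
    fun hs i => hs _
  have hnorm : ∀ U V W, specNorm U ≤ BU → specNorm V ≤ BV → specNorm W ≤ BW →
      ∀ X : Fin (t.val + 1) → EuclideanSpace ℝ (Fin dx), (∀ i, ‖X i‖ ≤ Bx) →
        ‖output (K := K) (dh := dh) σh σy U V W (t.val + 1) X‖ ≤ ρy * BV * l :=
    fun U V W hU hV hW X hX =>
      norm_output_le hσy h0y hV (norm_hidden_le_lam hb hσh h0 hσb hU hW K _ X hX)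
  have hΛ0 : 0 ≤ ρy * BV * l := by positivity
  rcases hΛ0.eq_or_lt with hΛ | hΛ
  · -- all outputs vanish, so the ramp risk is `1`
    refine (measure_mono (t := ∅) ?_).trans (by simp)
    rintro S ⟨hS, hbad⟩
    refine hbad fun γ hγ f hf => ?_
    obtain ⟨U, V, W, hU, hV, hW, rfl⟩ := hf
    rw [empRampRisk_eq_one_of_output_eq_zero hm0 hγ fun i => norm_le_zero_iff.1
      (hΛ ▸ hnorm U V W hU hV hW _ (hinputs (hS i)))]
    have h1 : misclass P φ t (output σh σy U V W (t.val + 1)) ≤ 1 := measureReal_le_one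
    have h2 := Real.sqrt_nonneg (Real.log (2 / δ) / (2 * (m : ℝ)))
    have h3 := hc γ hγ
    linarith
  -- nonzero outputs force `b`, `dh` and `K` to be positive, hence `d ≥ 1`
  have hlpos : 0 < l := by
    rcases hl0.eq_or_lt with h | h
    · rw [← h] at hΛ; simp at hΛ
    · exact h
  have hbd : 0 < b * √d := hlpos.trans_le (min_le_left _ _)
  have hb : 0 < b := pos_of_mul_pos_left hbd (Real.sqrt_nonneg _)
  have hdpos : 0 < d := Real.sqrt_pos.1 (pos_of_mul_pos_right hbd hb.le)
  have hdh : 0 < dh := by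
    rcases Nat.eq_zero_or_pos dh with h | h
    · subst h; simp [hd_def, effDim] at hdpos
    · exact h
  have hK : 0 < K := Fin.pos (φ 0)
  set D := dx * dh + dh ^ 2 + dh * K with hD_def
  have hD : 2 ≤ D := by
    have h1 : 1 ≤ dh ^ 2 := Nat.one_le_pow _ _ hdh
    have h2 : 1 ≤ dh * K := Nat.mul_pos hdh hK
    have h3 : 0 ≤ dx * dh := Nat.zero_le _
    omega
  have hdD : d = √(D : ℝ) := effDim_eq_sqrt_natCast dx dh K
  have hd1 : 1 ≤ d := by
    rw [hdD, Real.one_le_sqrt]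
    exact_mod_cast (by omega : 1 ≤ D)
  set A := β + 2 + ρh * Bx * BW / b with hA_def
  have hA2 : 2 ≤ A := by
    have : 0 ≤ ρh * Bx * BW / b := by positivity
    linarith
  set G := geomRatio β (t.val + 1) with hG_def
  have hG : 1 ≤ G := one_le_geomRatio_succ hβ _
  have hsm : 0 < √(m : ℝ) := Real.sqrt_pos.2 (by linarith)
  -- at this resolution the net moves the outputs by at most a fraction `1 / √m` of their size
  set n := ⌈d * A * G * √m⌉₊ with hn_def
  have hnpos : 0 < n := Nat.ceil_pos.2 (by positivity)
  have hn1 : d * A * G * √m ≤ n := Nat.le_ceil _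
  have hn2 : (n : ℝ) ≤ d * A * G * √m + 1 := (Nat.ceil_lt_add_one (by positivity)).le
  obtain ⟨F, hFcard, hF⟩ := exists_net_output (t := t.val + 1) (K := K) (dh := dh) (dx := dx)
    (σh := σh) (σy := σy) hb hBx hBU hBV hBW hσh hσy h0 hσb hd1 hG hnpos
  obtain ⟨hL1, hlogN⟩ := log_union_le (t := t.val + 1) (G := G) hD hA2 hG (by omega) hm hmA
    (hdD ▸ hn2)
  rw [← hdD] at hL1 hlogN
  set L := Real.log (((t.val + 1 : ℕ) : ℝ) * √(d * m) * G) with hL_def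
  set Λ := 2 * (ρy * BV * l) with hΛ_def
  have hΛpos : 0 < Λ := by positivity
  set w : ℝ := (t.val + 1) * (t.val + 2) with hw_def
  have hw1 : 1 ≤ w := by
    have : (0 : ℝ) ≤ t.val := by positivity
    nlinarith
  set N : ℝ := (((2 * n + 1) ^ D * m : ℕ) : ℝ) with hN_def
  have hN1 : 1 ≤ N := by
    rw [hN_def]
    exact_mod_cast Nat.mul_pos (by positivity) hm0
  have hw_eq : ((t.val + 1 : ℕ) : ℝ) * ((t.val + 1 : ℕ) + 1) = w := by
    rw [hw_def]; push_cast; ring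
  rw [hw_eq] at hlogN
  let Mθ : F → LabelledSeq dx K T → ℝ := fun θ s =>
    margin (output σh σy θ.1.1 θ.1.2.1 θ.1.2.2 (t.val + 1) (inputs s t)) (label s t)
  have hMθ : ∀ θ, Measurable (Mθ θ) := fun θ =>
    measurable_margin_output hσh.continuous hσy.continuous _ _ _ t
  have hscale : ∀ k : Fin m, 0 < Λ / ((k.1 + 1 : ℕ) : ℝ) := fun k => by positivity
  have hprob := measure_exists_deviation_le P (J := F × Fin m)
    (g := fun j s => ramp (Λ / (j.2.1 + 1 : ℕ)) (-Mθ j.1 s))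
    (fun j => (continuous_ramp_neg (hscale j.2)).measurable.comp (hMθ j.1))
    (fun j s => ⟨ramp_nonneg (hscale j.2) _, ramp_le_one (hscale j.2) _⟩) hm0
    (N := N) (δ := δ / w) (by positivity)
    (by
      rw [hN_def, Fintype.card_prod, Fintype.card_coe, Fintype.card_fin]
      exact_mod_cast Nat.mul_le_mul_right m hFcard)
    ((div_le_self hδ.le hw1).trans (by linarith))
  refine (measure_mono ?_).trans hprob
  rintro S ⟨hS, hbad⟩
  by_contra hgood
  refine hbad fun γ hγ f hf => ?_
  obtain ⟨U, V, W, hU, hV, hW, rfl⟩ := hf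
  simp only [Set.mem_ofPred_eq, not_exists, not_le] at hgood
  have hcomp : 12 * complexityTerm d ρh ρy b Bx BU BV BW m (t.val + 1) γ
      = 6 * (d * (Λ / γ) * √L / √m) := by
    rw [complexityTerm_eq, ← hβ_def, ← hl, ← hG_def, ← hL_def, hΛ_def]
    ring
  rw [hcomp]
  have hθ : 0 ≤ Λ / γ := by positivity
  have hdL : 1 ≤ d * √L := one_le_mul_of_one_le_of_one_le hd1 (Real.one_le_sqrt.2 hL1)
  rcases le_or_gt (Λ / γ) m with hγm | hγm
  swap
  · -- for so small a scale the complexity term alone exceeds `1`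
    have h1 : misclass P φ t (output σh σy U V W (t.val + 1)) ≤ 1 := measureReal_le_one
    have h2 := Real.sqrt_nonneg (Real.log (2 / δ) / (2 * (m : ℝ)))
    have h3 : 0 ≤ empRampRisk γ S t (output σh σy U V W (t.val + 1)) :=
      mul_nonneg (by positivity) (Finset.sum_nonneg fun i _ => ramp_nonneg hγ _)
    have h4 : 1 ≤ d * (Λ / γ) * √L / √m := by
      rw [one_le_div hsm]
      calc √(m : ℝ) ≤ m := Real.sqrt_le_self_iff.2 (Or.inr (by linarith))
        _ ≤ Λ / γ := hγm.le
        _ ≤ d * √L * (Λ / γ) := le_mul_of_one_le_left hθ hdL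
        _ = _ := by ring
    linarith
  obtain ⟨θ, hθF, hclose⟩ := hF U V W hU hV hW
  have hmain := measureReal_error_le_of_grid (P := P) (S := S) (γ := γ) (Λ := Λ)
    (A := {s | ∀ t, ‖(s t).1‖ ≤ Bx}) (ε := 1 / √m) (τ := √(Real.log (N / (δ / w)) / (2 * m)))
    (err := {s | φ (output σh σy U V W (t.val + 1) (inputs s t)) ≠ label s t})
    (M := fun s => margin (output σh σy U V W (t.val + 1) (inputs s t)) (label s t))
    hm0 hΛpos hγ hγm (hMθ ⟨θ, hθF⟩) hP hS
    (fun s hs => (margin_le_two_mul_norm _ _).trans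
      (mul_le_mul_of_nonneg_left (hnorm U V W hU hV hW _ (hinputs hs)) zero_le_two))
    (fun s hs => by
      refine (abs_margin_sub_le _ _ _).trans ?_
      have h1 := hclose _ (hinputs hs)
      have h2 : d * A * G / n ≤ 1 / √m := by
        rw [div_le_div_iff₀ (by exact_mod_cast hnpos) hsm]
        linarith
      have h3 : ρy * BV * l * (d * A * G / n) ≤ ρy * BV * l * (1 / √m) := by gcongr
      calc _ ≤ 2 * (ρy * BV * l * (1 / √m)) :=
            mul_le_mul_of_nonneg_left (h1.trans h3) zero_le_two
        _ = 1 / √m * Λ := by rw [hΛ_def]; ring)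
    (fun k => (hgood (⟨θ, hθF⟩, k)).le)
    (fun s hs => margin_nonpos_of_ne (hφ _) hs)
  have hdev := deviation_add_le hm0 (N := N * w) (δ := δ) (d := d) (L := L) (θ := Λ / γ)
    (by positivity) hδ hδ1 hd1 hL1 hlogN hθ
  have hNw : N / (δ / w) = N * w / δ := by field_simp
  rw [hNw] at hmain
  unfold misclass empRampRisk
  linarith

end

lemma sum_range_inv_mul_succ_le_one (T : ℕ) :
    ∑ t ∈ Finset.range T, 1 / (((t : ℝ) + 1) * (t + 2)) ≤ 1 := by
  have h : ∑ t ∈ Finset.range T, 1 / (((t : ℝ) + 1) * (t + 2)) = 1 - 1 / ((T : ℝ) + 1) := by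
    induction T with
    | zero => simp
    | succ n ih =>
      rw [Finset.sum_range_succ, ih]
      push_cast
      field_simp
      ring
  rw [h]
  have : 0 ≤ 1 / ((T : ℝ) + 1) := by positivity
  linarith

end VanillaRNN

theorem theorem2 :
    -- the constant of the `O` is absolute
    ∃ C : ℝ, 0 < C ∧
      ∀ (ρh ρy : ℝ≥0) (b Bx BU BV BW : ℝ),
        0 ≤ b → 0 ≤ Bx → 0 ≤ BU → 0 ≤ BV → 0 ≤ BW →
        -- the threshold for the sample size depends only on the constants above
        ∃ m₀ : ℕ, ∀ (dx dh K T : ℕ) (σh σy : ℝ → ℝ),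
          LipschitzWith ρh σh → LipschitzWith ρy σy → σh 0 = 0 → σy 0 = 0 →
          (∀ v, |σh v| ≤ b) →
          ∀ P : Measure (VanillaRNN.LabelledSeq dx K T), IsProbabilityMeasure P →
          (∀ᵐ s ∂P, ∀ t, ‖(s t).1‖ ≤ Bx) →
          -- `φ` is the argmax with an arbitrary rule for ties
          ∀ φ : EuclideanSpace ℝ (Fin K) → Fin K, (∀ (y : EuclideanSpace ℝ (Fin K)) (j : Fin K), y j ≤ y (φ y)) →
          ∀ m : ℕ, m₀ ≤ m → ∀ δ : ℝ, 0 < δ → δ < 1 →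
          -- the bound fails with probability at most `δ`
          (Measure.pi (fun _ : Fin m => P))
            {S | ¬ ∀ γ : ℝ, 0 < γ → ∀ t : Fin T,
              ∀ f ∈ VanillaRNN.rnnClass σh σy dx dh K BU BV BW (t.val + 1),
                VanillaRNN.misclass P φ t f ≤
                  VanillaRNN.empRampRisk γ S t f
                    + 3 * √(Real.log (2 / δ) / (2 * (m : ℝ)))
                    + C * VanillaRNN.complexityTerm (VanillaRNN.effDim dx dh K)
                        ρh ρy b Bx BU BV BW m (t.val + 1) γ}
            ≤ ENNReal.ofReal δ := by
  refine ⟨12, by norm_num, fun ρh ρy b Bx BU BV BW hb hBx hBU hBV hBW =>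
    ⟨max 9 ⌈36 * ((ρh : ℝ) * BU + 2 + ρh * Bx * BW / b) ^ 2⌉₊, ?_⟩⟩
  intro dx dh K T σh σy hσh hσy h0 h0y hσb P hPprob hP φ hφ m hm δ hδ hδ1
  have hm9 : 9 ≤ m := (le_max_left _ _).trans hm
  have hmA := Nat.ceil_le.1 ((le_max_right _ _).trans hm)
  -- samples with an input longer than `Bx` form a null set
  have hnull : (Measure.pi fun _ : Fin m => P) {S | ¬ ∀ i t, ‖(S i t).1‖ ≤ Bx} = 0 := by
    have h : ∀ᵐ S ∂(Measure.pi fun _ : Fin m => P), ∀ i t, ‖(S i t).1‖ ≤ Bx :=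
      ae_all_iff.2 fun i =>
        (measurePreserving_eval (fun _ : Fin m => P) i).quasiMeasurePreserving.ae hP
    exact h
  have htime := VanillaRNN.measure_bad_at_time_le (dh := dh) hb hBx hBU hBV hBW hσh hσy h0 h0y hσb
    P hP hφ hm9 hmA hδ hδ1
  refine (measure_mono (t := {S | ¬ ∀ i t, ‖(S i t).1‖ ≤ Bx} ∪ ⋃ t : Fin T,
    {S | (∀ i t, ‖(S i t).1‖ ≤ Bx) ∧ ¬ ∀ γ : ℝ, 0 < γ →
        ∀ f ∈ VanillaRNN.rnnClass σh σy dx dh K BU BV BW (t.val + 1),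
          VanillaRNN.misclass P φ t f ≤ VanillaRNN.empRampRisk γ S t f
            + 3 * √(Real.log (2 / δ) / (2 * (m : ℝ)))
            + 12 * VanillaRNN.complexityTerm (VanillaRNN.effDim dx dh K) ρh ρy b Bx BU BV BW m
                (t.val + 1) γ}) ?_).trans ((measure_union_le _ _).trans ?_)
  · intro S hS
    by_cases hgood : ∀ i t, ‖(S i t).1‖ ≤ Bx
    · right
      by_contra hnot
      refine hS fun γ hγ t f hf => ?_
      by_contra hlt
      exact hnot (Set.mem_iUnion.2 ⟨t, hgood, fun h => hlt (h γ hγ f hf)⟩)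
    · exact Or.inl hgood
  · rw [hnull, zero_add]
    refine (measure_iUnion_fintype_le _ _).trans ((Finset.sum_le_sum fun t _ => htime t).trans ?_)
    rw [← ENNReal.ofReal_sum_of_nonneg fun t _ => by positivity]
    -- the failure probabilities `δ / ((t + 1) (t + 2))` telescope, whatever `T` is
    refine ENNReal.ofReal_le_ofReal ?_
    rw [Fin.sum_univ_eq_sum_range (fun t : ℕ => δ / (((t : ℝ) + 1) * (t + 2))) T]
    have h := mul_le_mul_of_nonneg_left (VanillaRNN.sum_range_inv_mul_succ_le_one T) hδ.le
    rw [Finset.mul_sum, mul_one] at h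
    simpa only [mul_one_div] using h
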